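/- Let $\mathcal H$ be a real separable Hilbert space, $d$ a natural number, and let $\mathcal H^d$ carry the norm $\|b\|^2=\sum_{j=1}^d\|b_j\|^2$. Let $(\mathbf X_i,U_i)_{i\ge 1}$ be i.i.d. pairs of random elements of $\mathbb R^d\times\mathcal H$, with $\mathbf X_i$ independent of $U_i$, and let $Y_i=\mathbf X_i^{T}\boldsymbol\beta+U_i$ with a fixed $\boldsymbol\beta\in\mathcal H^d$, where $\mathbf x^{T}b=\sum_j x_jb_j\in\mathcal H$. Write $(\mathbf X,U)$ for a pair with the common law, and assume: 1. $\mathbf X$ is square integrable, and for some constant $C>0$ all eigenvalues of $\Sigma=\mathbb E(\mathbf X\mathbf X^{T})$ lie in $[1/C,C]$. 2. $0$ is the unique geometric median of $U$, i.e. the unique minimizer over $a\in\mathcal H$ of $\mathbb E\{\|U-a\|-\|U\|\}$. 3. There is a constant $C>0$ with $\mathbb E\{\|U-h\|^{-2}\}\le C$ for all $h\in\mathcal H$. 4. $\gamma_n=\gamma n^{-\alpha}$ for $n\ge1$, with constants $\gamma>0$ and $\alpha\in\mathbb R$, and $\sum_{n\ge1}\gamma_n=\infty$, $\sum_{n\ge1}\gamma_n^2<\infty$.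 Let $\boldsymbol\beta_1$ be a random element of $\mathcal H^d$ independent of $(\mathbf X_i,U_i)_{i\ge2}$, and for $n\ge1$ let $$\boldsymbol\beta_{n+1}=\boldsymbol\beta_n+\gamma_n\frac{\mathbf X_{n+1}(Y_{n+1}-\mathbf X_{n+1}^{T}\boldsymbol\beta_n)}{\|Y_{n+1}-\mathbf X_{n+1}^{T}\boldsymbol\beta_n\|},\qquad \bar{\boldsymbol\beta}_n=\frac1n\sum_{i=1}^n\boldsymbol\beta_i,$$ where $\mathbf x h=(x_1h,\dots,x_dh)$ and the quotient is read as $0$ if its denominator is $0$. Then $$\lim_{n\to\infty}\|\boldsymbol\beta_n-\boldsymbol\beta\|=0\ \text{ a.s.}\qquad\text{and}\qquad \lim_{n\to\infty}\|\bar{\boldsymbol\beta}_n-\boldsymbol\beta\|=0\ \text{ a.s.}$$ -/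

import Mathlib

open MeasureTheory ProbabilityTheory Filter Topology
open scoped ENNReal

namespace OnlineFSRM

section Definitions

/-- The space of slope functions: the `d`-fold Hilbert product `H^d`, with
`‖b‖² = ‖b 0‖² + ⋯ + ‖b (d-1)‖²`. -/
abbrev Slope (H : Type*) [NormedAddCommGroup H] (d : ℕ) : Type _ :=
  PiLp 2 (fun _ : Fin d => H)

variable {H : Type*} [NormedAddCommGroup H] [InnerProductSpace ℝ H]
variable {d : ℕ} {Ω : Type*} [MeasurableSpace Ω]

/-- The linear predictor `xᵀ b = ∑ j, x j • b j ∈ H`. -/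
def predictor (x : EuclideanSpace ℝ (Fin d)) (b : Slope H d) : H :=
  ∑ j, x j • b j

/-- The element `x h = (x 0 • h, …, x (d-1) • h)` of `H^d`. -/
def scaleBy (x : EuclideanSpace ℝ (Fin d)) (h : H) : Slope H d :=
  WithLp.toLp 2 (fun j => x j • h)

/-- One step of stochastic gradient descent from the current value `b`, with step size `g`
and new observation `(x, y)`: `b + g x (y - xᵀ b) / ‖y - xᵀ b‖`. -/
noncomputable def sgdStep (g : ℝ) (x : EuclideanSpace ℝ (Fin d)) (y : H) (b : Slope H d) :
    Slope H d :=
  b + g • ‖y - predictor x b‖⁻¹ • scaleBy x (y - predictor x b)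

/-- The SGD iterates `β_1, β_2, …`: `β_1` is the initial value and, for `n ≥ 1`, `β_{n+1}` is
obtained from `β_n` with step size `g n` and observation number `n + 1`.
The value at index `0` is not used. -/
noncomputable def sgd (g : ℕ → ℝ) (x : ℕ → EuclideanSpace ℝ (Fin d)) (y : ℕ → H)
    (init : Slope H d) : ℕ → Slope H d
  | 0 => init
  | 1 => init
  | n + 2 => sgdStep (g (n + 1)) (x (n + 2)) (y (n + 2)) (sgd g x y init (n + 1))

/-- The averaged (ASGD) estimator `(β_1 + ⋯ + β_n) / n`. -/
noncomputable def asgd (g : ℕ → ℝ) (x : ℕ → EuclideanSpace ℝ (Fin d)) (y : ℕ → H)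
    (init : Slope H d) (n : ℕ) : Slope H d :=
  (n : ℝ)⁻¹ • ∑ i ∈ Finset.Icc 1 n, sgd g x y init i

/-- The matrix `Σ = E (X Xᵀ)`. -/
noncomputable def secondMoment (μ : Measure Ω) (X : Ω → EuclideanSpace ℝ (Fin d)) :
    Matrix (Fin d) (Fin d) ℝ :=
  Matrix.of fun i j => ∫ ω, X ω i * X ω j ∂μ

theorem secondMoment_isHermitian (μ : Measure Ω) (X : Ω → EuclideanSpace ℝ (Fin d)) :
    (secondMoment μ X).IsHermitian := by
  ext i j
  simp [secondMoment, mul_comm]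

/-- `X` is square integrable and the eigenvalues of `Σ = E (X Xᵀ)` lie in `[1/C, C]` for some
constant `C > 0`. -/
def CovariateCondition (μ : Measure Ω) (X : Ω → EuclideanSpace ℝ (Fin d)) : Prop :=
  MemLp X 2 μ ∧ ∃ C : ℝ, 0 < C ∧ ∀ i,
    1 / C ≤ (secondMoment_isHermitian μ X).eigenvalues i ∧
      (secondMoment_isHermitian μ X).eigenvalues i ≤ C

/-- `m` is a geometric median of the random element `V`: it minimizes
`a ↦ E (‖V - a‖ - ‖V‖)` over `H`. The integrand is bounded by `‖a‖`. -/
def IsGeometricMedian (μ : Measure Ω) (V : Ω → H) (m : H) : Prop :=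
  ∀ a : H, ∫ ω, (‖V ω - m‖ - ‖V ω‖) ∂μ ≤ ∫ ω, (‖V ω - a‖ - ‖V ω‖) ∂μ

/-- Zero is the unique geometric median of `V`. -/
def UniqueMedianZero (μ : Measure Ω) (V : Ω → H) : Prop :=
  IsGeometricMedian μ V 0 ∧ ∀ m : H, IsGeometricMedian μ V m → m = 0

/-- `V` is not strongly concentrated around a point: `E ‖V - h‖⁻² ≤ C` for all `h`, with one
constant `C`; here `‖V - h‖⁻² = ∞` where `V = h`. -/
def NotConcentrated (μ : Measure Ω) (V : Ω → H) : Prop :=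
  ∃ C : ℝ, 0 < C ∧ ∀ h : H, ∫⁻ ω, (‖V ω - h‖ₑ ^ 2)⁻¹ ∂μ ≤ ENNReal.ofReal C

/-- The step sizes `γ_n = γ n^{-α}`, `n ≥ 1`. -/
noncomputable def stepSize (γ α : ℝ) (n : ℕ) : ℝ := γ * (n : ℝ) ^ (-α)

/-- The Robbins–Monro conditions `∑ γ_n = ∞` and `∑ γ_n² < ∞`, the sums being over `n ≥ 1`. -/
def RobbinsMonro (g : ℕ → ℝ) : Prop :=
  Tendsto (fun N : ℕ => ∑ n ∈ Finset.Icc 1 N, g n) atTop atTop ∧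
    Summable (fun n : ℕ => g (n + 1) ^ 2)

/-- The observations number `1, 2, …` form an i.i.d. sample of the function-on-scalar regression
model `Y = Xᵀ β + U` with `U` independent of `X`, and the initial value `init` is a random
element of `H^d` that is independent of the observations used after it, number `2, 3, …`.
The values at index `0` are not used. -/
structure IsSample [MeasurableSpace H] [BorelSpace H] (μ : Measure Ω) (β : Slope H d)
    (X : ℕ → Ω → EuclideanSpace ℝ (Fin d)) (U Y : ℕ → Ω → H) (init : Ω → Slope H d) :
    Prop where
  measurable_X : ∀ i, 1 ≤ i → Measurable (X i)
  measurable_U : ∀ i, 1 ≤ i → Measurable (U i)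
  measurable_init : Measurable init
  indep_X_U : ∀ i, 1 ≤ i → IndepFun (X i) (U i) μ
  indep : iIndepFun (fun (i : ℕ) ω => (X (i + 1) ω, U (i + 1) ω)) μ
  identDistrib : ∀ i, 1 ≤ i →
    IdentDistrib (fun ω => (X i ω, U i ω)) (fun ω => (X 1 ω, U 1 ω)) μ μ
  indep_init : IndepFun init (fun ω (i : ℕ) => (X (i + 2) ω, U (i + 2) ω)) μ
  model : ∀ i, 1 ≤ i → ∀ ω, Y i ω = predictor (X i ω) β + U i ω

end Definitions

end OnlineFSRM

/-!
Write `δ_n = β_n - β` for the error. It follows the same gradient recursion with true slope `0` and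
responses `U`. The loss `h ↦ ‖u - h‖` is convex, and its subgradient inequality between the current
prediction and `0` (`inner_direction_le`) gives, pointwise,
`‖δ_{n+1}‖² ≤ ‖δ_n‖² - 2 γ_n (‖U - Xᵀ δ_n‖ - ‖U‖) + γ_n² ‖X‖²` (`norm_sgdStep_sq_le`).
The new observation is independent of the past, so averaging over it replaces the middle bracket
by the risk `Φ (δ_n) = E (‖U - Xᵀ b‖ - ‖U‖)` at `b = δ_n` (`setIntegral_comp_eq_of_indep`), which is
nonnegative because `0` is a median. As `∑ γ_n² < ∞`, the Robbins–Siegmund theorem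
(`ae_tendsto_and_summable_of_almost_supermartingale`) shows that almost surely `‖δ_n‖²` converges
and `∑ γ_n Φ (δ_n) < ∞`. As `∑ γ_n = ∞`, the risk `Φ (δ_n)` tends to `0` along a subsequence.

What remains is that `Φ` cannot be small away from `0` on bounded sets, which in infinite dimension
is not a matter of compactness alone. Weak compactness handles the excess risk of `U` itself
(`UniqueMedianZero.tendsto_zero_of_excessRisk`): if norms are lost in a weak limit, the limit of the
risks strictly exceeds the risk at the weak limit. Independence of `X` and `U` and invertibility of
`Σ = E (X Xᵀ)` carry this over to slopes (`exists_subseq_tendsto_zero_of_slopeRisk`). So `δ_n → 0`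
along a subsequence, and the limit of `‖δ_n‖²` is `0`. The averages follow by Cesàro's theorem.

The initial value need not be integrable; it is truncated, and the truncated recursions are glued
(`ae_tendsto_sgdError`).
-/

namespace OnlineFSRM

/-! ### The linear predictor and one gradient step -/

section Predictor

variable {H : Type*} [NormedAddCommGroup H] [InnerProductSpace ℝ H] {d : ℕ}

theorem continuous_predictor :
    Continuous fun p : EuclideanSpace ℝ (Fin d) × Slope H d => predictor p.1 p.2 := by
  unfold predictor; fun_prop

theorem predictor_sub (x : EuclideanSpace ℝ (Fin d)) (b c : Slope H d) :
    predictor x (b - c) = predictor x b - predictor x c := by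
  simp [predictor, smul_sub, Finset.sum_sub_distrib]

/-- Cauchy–Schwarz for the bilinear pairing of `ℝ^d` with `H^d`. -/
theorem norm_predictor_le (x : EuclideanSpace ℝ (Fin d)) (b : Slope H d) :
    ‖predictor x b‖ ≤ ‖x‖ * ‖b‖ := by
  rw [EuclideanSpace.norm_eq, PiLp.norm_eq_of_L2]
  calc ‖predictor x b‖ ≤ ∑ j, ‖x j‖ * ‖b j‖ := by
        refine (norm_sum_le _ _).trans (le_of_eq ?_)
        simp [norm_smul]
    _ ≤ _ := Real.sum_mul_le_sqrt_mul_sqrt _ _ _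

theorem norm_scaleBy (x : EuclideanSpace ℝ (Fin d)) (h : H) :
    ‖scaleBy x h‖ = ‖x‖ * ‖h‖ := by
  rw [EuclideanSpace.norm_eq, PiLp.norm_eq_of_L2, ← Real.sqrt_sq (norm_nonneg h),
    ← Real.sqrt_mul (by positivity), Finset.sum_mul]
  simp [scaleBy, norm_smul, mul_pow]

/-- `h ↦ x h` is the adjoint of the linear predictor `b ↦ xᵀ b`. -/
theorem inner_scaleBy (x : EuclideanSpace ℝ (Fin d)) (b : Slope H d) (h : H) :
    inner ℝ b (scaleBy x h) = inner ℝ (predictor x b) h := by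
  simp [PiLp.inner_apply, scaleBy, predictor, sum_inner, inner_smul_left, inner_smul_right]

/-- The unit vector pointing from `h` to `u` satisfies the subgradient inequality of
`h ↦ ‖u - h‖` between the points `h` and `0`. The convention `‖0‖⁻¹ • 0 = 0` is harmless: at
`h = u` the right-hand side is `‖u‖`. -/
theorem inner_direction_le (u h : H) :
    inner ℝ h (‖u - h‖⁻¹ • (u - h)) ≤ ‖u‖ - ‖u - h‖ := by
  rw [inner_smul_right]
  rcases eq_or_ne (u - h) 0 with h0 | h0
  · simp [h0]
  · have hp : 0 < ‖u - h‖ := norm_pos_iff.2 h0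
    rw [inv_mul_le_iff₀ hp]
    have h1 : inner ℝ h (u - h) = inner ℝ u (u - h) - ‖u - h‖ ^ 2 := by
      rw [← real_inner_self_eq_norm_sq, ← inner_sub_left]; simp
    have h2 := real_inner_le_norm u (u - h)
    nlinarith

theorem norm_direction_le (v : H) : ‖‖v‖⁻¹ • v‖ ≤ 1 := by
  rcases eq_or_ne v 0 with rfl | hv
  · simp
  · rw [norm_smul, norm_inv, norm_norm, inv_mul_cancel₀ (norm_ne_zero_iff.2 hv)]

theorem scaleBy_smul (x : EuclideanSpace ℝ (Fin d)) (c : ℝ) (h : H) :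
    scaleBy x (c • h) = c • scaleBy x h := by
  ext j; simp [scaleBy, smul_comm c]

/-- One gradient step lowers the squared distance to the true slope by `2 g` times the excess
loss of the prediction, up to a second-order term. -/
theorem norm_sgdStep_sq_le {g : ℝ} (hg : 0 ≤ g) (x : EuclideanSpace ℝ (Fin d)) (u : H)
    (b : Slope H d) :
    ‖sgdStep g x u b‖ ^ 2 ≤
      ‖b‖ ^ 2 - 2 * g * (‖u - predictor x b‖ - ‖u‖) + g ^ 2 * ‖x‖ ^ 2 := by
  unfold sgdStep
  rw [← scaleBy_smul, norm_add_sq_real, inner_smul_right, inner_scaleBy, norm_smul, norm_scaleBy]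
  have h1 := inner_direction_le u (predictor x b)
  have h2 : (‖x‖ * ‖‖u - predictor x b‖⁻¹ • (u - predictor x b)‖) ^ 2 ≤ ‖x‖ ^ 2 := by
    apply pow_le_pow_left₀ (by positivity)
    exact mul_le_of_le_one_right (norm_nonneg _) (norm_direction_le _)
  have h3 : (‖g‖ * (‖x‖ * ‖‖u - predictor x b‖⁻¹ • (u - predictor x b)‖)) ^ 2
      ≤ g ^ 2 * ‖x‖ ^ 2 := by
    rw [mul_pow, Real.norm_eq_abs, sq_abs]
    exact mul_le_mul_of_nonneg_left h2 (sq_nonneg _)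
  nlinarith [mul_le_mul_of_nonneg_left h1 hg]

theorem norm_sgdStep_le {g : ℝ} (hg : 0 ≤ g) (x : EuclideanSpace ℝ (Fin d)) (u : H)
    (b : Slope H d) : ‖sgdStep g x u b‖ ≤ ‖b‖ + g * ‖x‖ := by
  unfold sgdStep
  rw [← scaleBy_smul]
  refine (norm_add_le _ _).trans ?_
  rw [norm_smul, norm_scaleBy, Real.norm_of_nonneg hg]
  gcongr
  exact mul_le_of_le_one_right (norm_nonneg _) (norm_direction_le _)

/-- Gradient descent for the model `y = xᵀ β + u`, started at `b` and measured from `β`, is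
gradient descent for the model with slope `0`. -/
theorem sgdStep_sub (g : ℝ) (x : EuclideanSpace ℝ (Fin d)) (u : H) (β b : Slope H d) :
    sgdStep g x (predictor x β + u) b - β = sgdStep g x u (b - β) := by
  have h : predictor x β + u - predictor x b = u - predictor x (b - β) := by
    rw [predictor_sub]; abel
  unfold sgdStep
  rw [h]; abel

theorem abs_norm_sub_predictor_sub_le (x : EuclideanSpace ℝ (Fin d)) (u : H) (b : Slope H d) :
    |‖u - predictor x b‖ - ‖u‖| ≤ ‖x‖ * ‖b‖ := by
  refine le_trans ?_ (norm_predictor_le x b)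
  have := abs_norm_sub_norm_le (u - predictor x b) u
  simpa using this

end Predictor

/-! ### Well-posedness of the geometric median -/

section Median

variable {H : Type*} [NormedAddCommGroup H] {Ω : Type*} [MeasurableSpace Ω]

/-- The excess risk `E (‖V - h‖ - ‖V‖)` whose minimizers are the geometric medians of `V`. -/
noncomputable def excessRisk (μ : Measure Ω) (V : Ω → H) (h : H) : ℝ :=
  ∫ ω, (‖V ω - h‖ - ‖V ω‖) ∂μ

theorem UniqueMedianZero.excessRisk_nonneg {μ : Measure Ω} {V : Ω → H}
    (hV : UniqueMedianZero μ V) (h : H) : 0 ≤ excessRisk μ V h := by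
  have := hV.1 h
  simpa [excessRisk] using this

variable [InnerProductSpace ℝ H]

/-- Bounded sequences in a separable Hilbert space have weakly convergent subsequences. -/
theorem exists_subseq_tendsto_inner [CompleteSpace H] [TopologicalSpace.SeparableSpace H]
    {M : ℝ} (h : ℕ → H) (hM : ∀ k, ‖h k‖ ≤ M) :
    ∃ a : H, ∃ φ : ℕ → ℕ, StrictMono φ ∧
      ∀ u : H, Tendsto (fun k => inner ℝ (h (φ k)) u) atTop (𝓝 (inner ℝ a u)) := by
  obtain ⟨a, -, φ, hφ, hlim⟩ := WeakDual.isSeqCompact_closedBall ℝ H 0 M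
    (x := fun k => StrongDual.toWeakDual (InnerProductSpace.toDual ℝ H (h k)))
    (fun k => by simpa using hM k)
  refine ⟨(InnerProductSpace.toDual ℝ H).symm (WeakDual.toStrongDual a), φ, hφ, fun u => ?_⟩
  have h1 := ((WeakDual.eval_continuous (𝕜 := ℝ) u).tendsto a).comp hlim
  simpa [Function.comp_def] using h1

/-- The median problem is well posed: a bounded sequence of approximate minimizers of the excess
risk converges in norm to the median. Along a weakly convergent subsequence with weak limit `a`
and norms tending to `r`, the risk tends to `E (√(‖V - a‖² + r² - ‖a‖²) - ‖V‖)`, which dominates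
the risk of `a`; so `a = 0` by uniqueness, and then `r = 0`. -/
theorem UniqueMedianZero.tendsto_zero_of_excessRisk [CompleteSpace H]
    [SecondCountableTopology H] [MeasurableSpace H] [BorelSpace H]
    {μ : Measure Ω} [IsProbabilityMeasure μ] {V : Ω → H} (hVm : Measurable V)
    (hV : UniqueMedianZero μ V) {M : ℝ} {h : ℕ → H} (hM : ∀ k, ‖h k‖ ≤ M)
    (hlim : Tendsto (fun k => excessRisk μ V (h k)) atTop (𝓝 0)) :
    Tendsto h atTop (𝓝 0) := by
  refine tendsto_of_subseq_tendsto fun ns hns => ?_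
  obtain ⟨a, φ, hφ, hweak⟩ := exists_subseq_tendsto_inner (fun k => h (ns k)) (fun k => hM _)
  obtain ⟨r, -, ψ, hψ, hr⟩ := tendsto_subseq_of_bounded
    (Metric.isBounded_Icc (0 : ℝ) M) (x := fun k => ‖h (ns (φ k))‖)
    (fun k => ⟨norm_nonneg _, hM _⟩)
  refine ⟨φ ∘ ψ, ?_⟩
  set c : ℕ → H := fun k => h (ns (φ (ψ k))) with hc
  have hcw : ∀ u : H, Tendsto (fun k => inner ℝ (c k) u) atTop (𝓝 (inner ℝ a u)) :=
    fun u => (hweak u).comp hψ.tendsto_atTop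
  have hcr : Tendsto (fun k => ‖c k‖) atTop (𝓝 r) := hr
  have hcG : Tendsto (fun k => excessRisk μ V (c k)) atTop (𝓝 0) :=
    hlim.comp (hns.comp (hφ.tendsto_atTop.comp hψ.tendsto_atTop))
  have hr0 : 0 ≤ r := ge_of_tendsto' hcr fun _ => norm_nonneg _
  have har : ‖a‖ ≤ r := by
    have h1 : inner ℝ a a ≤ r * ‖a‖ :=
      le_of_tendsto_of_tendsto' (hcw a) (hcr.mul_const _) fun k => real_inner_le_norm _ _
    rw [real_inner_self_eq_norm_sq] at h1
    by_contra! h2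
    nlinarith [norm_nonneg a]
  have hpt : ∀ v : H, Tendsto (fun k => ‖v - c k‖) atTop
      (𝓝 √(‖v - a‖ ^ 2 + (r ^ 2 - ‖a‖ ^ 2))) := by
    intro v
    have h1 : Tendsto (fun k => ‖v‖ ^ 2 - 2 * inner ℝ (c k) v + ‖c k‖ ^ 2) atTop
        (𝓝 (‖v‖ ^ 2 - 2 * inner ℝ a v + r ^ 2)) :=
      (tendsto_const_nhds.sub ((hcw v).const_mul 2)).add (hcr.pow 2)
    have h2 := (Real.continuous_sqrt.tendsto _).comp h1
    have h3 : ‖v‖ ^ 2 - 2 * inner ℝ a v + r ^ 2 = ‖v - a‖ ^ 2 + (r ^ 2 - ‖a‖ ^ 2) := by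
      rw [norm_sub_sq_real, real_inner_comm]; ring
    rw [h3] at h2
    refine h2.congr fun k => ?_
    rw [Function.comp_apply, ← Real.sqrt_sq (norm_nonneg (v - c k)), norm_sub_sq_real,
      real_inner_comm]
  have hbd : ∀ k ω, ‖‖V ω - c k‖ - ‖V ω‖‖ ≤ M := by
    intro k ω
    refine le_trans ?_ (hM (ns (φ (ψ k))))
    simpa using abs_norm_sub_norm_le (V ω - c k) (V ω)
  have hint : Tendsto (fun k => excessRisk μ V (c k)) atTop
      (𝓝 (∫ ω, (√(‖V ω - a‖ ^ 2 + (r ^ 2 - ‖a‖ ^ 2)) - ‖V ω‖) ∂μ)) := by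
    refine tendsto_integral_of_dominated_convergence (fun _ => M) (fun k => ?_)
      (integrable_const _) (fun k => ae_of_all _ (hbd k))
      (ae_of_all _ fun ω => (hpt (V ω)).sub_const _)
    exact (((hVm.sub_const _).norm).sub hVm.norm).aestronglyMeasurable
  have hzero := tendsto_nhds_unique hint hcG
  have hbdlim : ∀ ω, |√(‖V ω - a‖ ^ 2 + (r ^ 2 - ‖a‖ ^ 2)) - ‖V ω‖| ≤ M := fun ω =>
    le_of_tendsto' ((hpt (V ω)).sub_const _).abs fun k => hbd k ω
  have hI1 : Integrable (fun ω => √(‖V ω - a‖ ^ 2 + (r ^ 2 - ‖a‖ ^ 2)) - ‖V ω‖) μ := by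
    refine Integrable.of_bound ?_ M (ae_of_all _ hbdlim)
    have h1 : Measurable fun ω => ‖V ω - a‖ := (hVm.sub_const _).norm
    exact ((Real.continuous_sqrt.measurable.comp
      ((h1.pow_const 2).add_const _)).sub hVm.norm).aestronglyMeasurable
  have hI2 : Integrable (fun ω => ‖V ω - a‖ - ‖V ω‖) μ := by
    refine Integrable.of_bound
      (((hVm.sub_const _).norm).sub hVm.norm).aestronglyMeasurable ‖a‖ (ae_of_all _ fun ω => ?_)
    simpa using abs_norm_sub_norm_le (V ω - a) (V ω)
  have hsq : 0 ≤ r ^ 2 - ‖a‖ ^ 2 := by nlinarith [norm_nonneg a]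
  have ha : a = 0 := by
    apply hV.2
    intro b
    have h1 : ∫ ω, (‖V ω - a‖ - ‖V ω‖) ∂μ ≤ 0 := by
      rw [← hzero]
      refine integral_mono hI2 hI1 fun ω => ?_
      have : ‖V ω - a‖ ≤ √(‖V ω - a‖ ^ 2 + (r ^ 2 - ‖a‖ ^ 2)) :=
        Real.le_sqrt_of_sq_le (by linarith)
      simpa using this
    exact h1.trans (hV.excessRisk_nonneg b)
  subst ha
  simp only [sub_zero, norm_zero, ne_eq, OfNat.ofNat_ne_zero, not_false_eq_true, zero_pow]
    at hzero hI1
  have hae := (integral_eq_zero_iff_of_nonneg (fun ω => by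
    have : ‖V ω‖ ≤ √(‖V ω‖ ^ 2 + r ^ 2) := Real.le_sqrt_of_sq_le (by nlinarith)
    simpa using this) hI1).1 hzero
  obtain ⟨ω, hω⟩ := hae.exists
  have hrz : r = 0 := by
    have h1 : √(‖V ω‖ ^ 2 + r ^ 2) = ‖V ω‖ := by
      simpa [sub_eq_zero] using hω
    have h2 := Real.sq_sqrt (show 0 ≤ ‖V ω‖ ^ 2 + r ^ 2 by positivity)
    rw [h1] at h2
    exact pow_eq_zero_iff (n := 2) (by norm_num) |>.1 (by linarith)
  rw [hrz] at hcr
  exact tendsto_zero_iff_norm_tendsto_zero.2 hcr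

end Median

/-! ### The excess risk of a slope -/

section SlopeRisk

variable {H : Type*} [NormedAddCommGroup H] [InnerProductSpace ℝ H]
variable {d : ℕ} {Ω : Type*} [MeasurableSpace Ω]

/-- The excess risk `E (‖U - Xᵀ b‖ - ‖U‖)` of a slope `b`, when the true slope is `0`. -/
noncomputable def slopeRisk (μ : Measure Ω) (X : Ω → EuclideanSpace ℝ (Fin d)) (U : Ω → H)
    (b : Slope H d) : ℝ :=
  ∫ ω, (‖U ω - predictor (X ω) b‖ - ‖U ω‖) ∂μ

variable [SecondCountableTopology H] [MeasurableSpace H] [BorelSpace H]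

theorem measurable_predictor :
    Measurable fun p : EuclideanSpace ℝ (Fin d) × Slope H d => predictor p.1 p.2 :=
  continuous_predictor.measurable

theorem measurable_excess :
    Measurable fun p : (EuclideanSpace ℝ (Fin d) × H) × Slope H d =>
      ‖p.1.2 - predictor p.1.1 p.2‖ - ‖p.1.2‖ := by
  have h := (measurable_predictor (H := H) (d := d)).comp
    ((measurable_fst.comp measurable_fst).prodMk measurable_snd :
      Measurable fun p : (EuclideanSpace ℝ (Fin d) × H) × Slope H d => (p.1.1, p.2))
  have h2 : Measurable fun p : (EuclideanSpace ℝ (Fin d) × H) × Slope H d => p.1.2 :=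
    measurable_snd.comp measurable_fst
  exact ((h2.sub h).norm).sub h2.norm

theorem measurable_sgdStep (g : ℝ) :
    Measurable fun p : (EuclideanSpace ℝ (Fin d) × H) × Slope H d =>
      sgdStep g p.1.1 p.1.2 p.2 := by
  have h := (measurable_predictor (H := H) (d := d)).comp
    ((measurable_fst.comp measurable_fst).prodMk measurable_snd :
      Measurable fun p : (EuclideanSpace ℝ (Fin d) × H) × Slope H d => (p.1.1, p.2))
  have h1 : Measurable fun p : (EuclideanSpace ℝ (Fin d) × H) × Slope H d => p.1.1 :=
    measurable_fst.comp measurable_fst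
  have h2 : Measurable fun p : (EuclideanSpace ℝ (Fin d) × H) × Slope H d => p.1.2 :=
    measurable_snd.comp measurable_fst
  have h3 := h2.sub h
  have hc : Continuous fun p : EuclideanSpace ℝ (Fin d) × H => scaleBy p.1 p.2 := by
    unfold scaleBy; fun_prop
  unfold sgdStep
  exact measurable_snd.add
    (((h3.norm.inv).smul (hc.measurable.comp (h1.prodMk h3))).const_smul g)

variable {μ : Measure Ω} [IsProbabilityMeasure μ]
  {X : Ω → EuclideanSpace ℝ (Fin d)} {U : Ω → H}

theorem integrable_excess (hX : Measurable X) (hX2 : MemLp X 2 μ) (hU : Measurable U)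
    (b : Slope H d) : Integrable (fun ω => ‖U ω - predictor (X ω) b‖ - ‖U ω‖) μ := by
  refine ((hX2.integrable (by norm_num)).norm.mul_const ‖b‖).mono' ?_
    (ae_of_all _ fun ω => abs_norm_sub_predictor_sub_le _ _ _)
  exact (measurable_excess.comp ((hX.prodMk hU).prodMk measurable_const)).aestronglyMeasurable

omit [SecondCountableTopology H] [MeasurableSpace H] [BorelSpace H] in
theorem abs_slopeRisk_le (hX2 : MemLp X 2 μ) (b : Slope H d) :
    |slopeRisk μ X U b| ≤ (∫ ω, ‖X ω‖ ∂μ) * ‖b‖ := by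
  rw [← integral_mul_const, ← Real.norm_eq_abs]
  exact norm_integral_le_of_norm_le ((hX2.integrable (by norm_num)).norm.mul_const ‖b‖)
    (ae_of_all _ fun ω => abs_norm_sub_predictor_sub_le (X ω) (U ω) b)

theorem measurable_slopeRisk (hX : Measurable X) (hU : Measurable U) :
    Measurable (slopeRisk μ X U) := by
  have h : StronglyMeasurable fun p : Slope H d × Ω =>
      ‖U p.2 - predictor (X p.2) p.1‖ - ‖U p.2‖ :=
    (measurable_excess.comp (((hX.comp measurable_snd).prodMk
      (hU.comp measurable_snd)).prodMk measurable_fst)).stronglyMeasurable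
  exact h.integral_prod_right'.measurable

/-- Since `X` is independent of `U`, the risk of a slope averages the excess risk of `U` over the
predictions. -/
theorem slopeRisk_eq_integral_excessRisk (hX : Measurable X) (hX2 : MemLp X 2 μ)
    (hU : Measurable U) (hind : IndepFun X U μ) (b : Slope H d) :
    Integrable (fun ω => excessRisk μ U (predictor (X ω) b)) μ ∧
      slopeRisk μ X U b = ∫ ω, excessRisk μ U (predictor (X ω) b) ∂μ := by
  set f : EuclideanSpace ℝ (Fin d) × H → ℝ := fun p => ‖p.2 - predictor p.1 b‖ - ‖p.2‖ with hf
  have hfm : Measurable f :=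
    measurable_excess.comp (measurable_id.prodMk measurable_const)
  have hmap := (indepFun_iff_map_prod_eq_prod_map_map hX.aemeasurable hU.aemeasurable).1 hind
  have : IsProbabilityMeasure (μ.map X) := Measure.isProbabilityMeasure_map hX.aemeasurable
  have : IsProbabilityMeasure (μ.map U) := Measure.isProbabilityMeasure_map hU.aemeasurable
  have hfi : Integrable f ((μ.map X).prod (μ.map U)) := by
    rw [← hmap, integrable_map_measure hfm.aestronglyMeasurable (hX.prodMk hU).aemeasurable]
    exact integrable_excess hX hX2 hU b
  have hinner : ∀ x, ∫ u, f (x, u) ∂(μ.map U) = excessRisk μ U (predictor x b) := by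
    intro x
    rw [integral_map hU.aemeasurable]
    · rfl
    · exact (hfm.comp (measurable_const.prodMk measurable_id)).aestronglyMeasurable
  have hi := hfi.integral_prod_left
  simp only [hinner] at hi
  refine ⟨?_, ?_⟩
  · exact (integrable_map_measure hi.aestronglyMeasurable hX.aemeasurable).1 hi
  · have h1 : slopeRisk μ X U b = ∫ p, f p ∂((μ.map X).prod (μ.map U)) := by
      rw [← hmap, integral_map (hX.prodMk hU).aemeasurable hfm.aestronglyMeasurable]
      rfl
    rw [h1, integral_prod _ hfi]
    simp only [hinner]
    rw [integral_map hX.aemeasurable hi.aestronglyMeasurable]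

theorem slopeRisk_nonneg (hX : Measurable X) (hX2 : MemLp X 2 μ)
    (hU : Measurable U) (hind : IndepFun X U μ) (hmed : UniqueMedianZero μ U) (b : Slope H d) :
    0 ≤ slopeRisk μ X U b := by
  rw [(slopeRisk_eq_integral_excessRisk hX hX2 hU hind b).2]
  exact integral_nonneg fun ω => hmed.excessRisk_nonneg _

omit [IsProbabilityMeasure μ] in
theorem memLp_two_coord (hX2 : MemLp X 2 μ) (i : Fin d) : MemLp (fun ω => X ω i) 2 μ :=
  (EuclideanSpace.proj i : EuclideanSpace ℝ (Fin d) →L[ℝ] ℝ).comp_memLp' hX2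

omit [SecondCountableTopology H] [MeasurableSpace H] [BorelSpace H] [IsProbabilityMeasure μ] in
/-- The normal equations `E (X_i Xᵀ b) = (Σ b)_i`. -/
theorem integral_coord_smul_predictor [CompleteSpace H] (hX2 : MemLp X 2 μ) (b : Slope H d)
    (i : Fin d) :
    ∫ ω, X ω i • predictor (X ω) b ∂μ = ∑ j, secondMoment μ X i j • b j := by
  have h : ∀ j, Integrable (fun ω => (X ω i * X ω j) • b j) μ := fun j =>
    ((memLp_two_coord hX2 i).integrable_mul (memLp_two_coord hX2 j)).smul_const _
  simp only [predictor, Finset.smul_sum, smul_smul]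
  rw [integral_finsetSum _ fun j _ => h j]
  simp [secondMoment, integral_smul_const]

/-- Bounded slopes whose risk tends to zero tend to zero along a subsequence. The excess risk of
the prediction `Xᵀ b_k` tends to `0` in mean, so a subsequence of it does so almost surely and
`Xᵀ b_k → 0` almost surely along it; then `b_k = Σ⁻¹ E (X Xᵀ b_k) → 0`. -/
theorem exists_subseq_tendsto_zero_of_slopeRisk [CompleteSpace H] (hX : Measurable X)
    (hcov : CovariateCondition μ X) (hU : Measurable U) (hind : IndepFun X U μ)
    (hmed : UniqueMedianZero μ U) {M : ℝ} {b : ℕ → Slope H d} (hM : ∀ k, ‖b k‖ ≤ M)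
    (hlim : Tendsto (fun k => slopeRisk μ X U (b k)) atTop (𝓝 0)) :
    ∃ φ : ℕ → ℕ, StrictMono φ ∧ Tendsto (fun k => b (φ k)) atTop (𝓝 0) := by
  obtain ⟨hX2, C, hC, heig⟩ := hcov
  have hpos : (secondMoment μ X).PosDef :=
    (secondMoment_isHermitian μ X).posDef_iff_eigenvalues_pos.2 fun i =>
      lt_of_lt_of_le (by positivity) (heig i).1
  have hdet : IsUnit (secondMoment μ X).det := (hpos.det_pos.ne').isUnit
  set S := secondMoment μ X with hS
  have hrisk := fun k => slopeRisk_eq_integral_excessRisk hX hX2 hU hind (b k)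
  have hL1 : Tendsto (fun k => eLpNorm
      ((fun ω => excessRisk μ U (predictor (X ω) (b k))) - 0) 1 μ) atTop (𝓝 0) := by
    have h1 := ENNReal.tendsto_ofReal hlim
    rw [ENNReal.ofReal_zero] at h1
    refine h1.congr fun k => ?_
    rw [sub_zero, eLpNorm_one_eq_lintegral_enorm, (hrisk k).2,
      ofReal_integral_eq_lintegral_ofReal (hrisk k).1
        (ae_of_all _ fun ω => hmed.excessRisk_nonneg _)]
    exact lintegral_congr fun ω => (Real.enorm_of_nonneg (hmed.excessRisk_nonneg _)).symm
  obtain ⟨φ, hφ, hae⟩ := (tendstoInMeasure_of_tendsto_eLpNorm one_ne_zero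
    (fun k => (hrisk k).1.aestronglyMeasurable) aestronglyMeasurable_const hL1).exists_seq_tendsto_ae
  refine ⟨φ, hφ, ?_⟩
  have hM0 : 0 ≤ M := (norm_nonneg _).trans (hM 0)
  have hpred : ∀ᵐ ω ∂μ, Tendsto (fun k => predictor (X ω) (b (φ k))) atTop (𝓝 0) := by
    filter_upwards [hae] with ω hω
    refine hmed.tendsto_zero_of_excessRisk hU (M := ‖X ω‖ * M) (fun k => ?_) hω
    exact (norm_predictor_le _ _).trans (mul_le_mul_of_nonneg_left (hM _) (norm_nonneg _))
  have hmoment : ∀ i, Tendsto (fun k => ∑ j, S i j • (b (φ k)) j) atTop (𝓝 0) := by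
    intro i
    have h1 : Tendsto (fun k => ∫ ω, X ω i • predictor (X ω) (b (φ k)) ∂μ) atTop
        (𝓝 (∫ _, (0 : H) ∂μ)) := by
      refine tendsto_integral_of_dominated_convergence (fun ω => ‖X ω‖ ^ 2 * M) (fun k => ?_)
        ((hX2.integrable_norm_pow two_ne_zero).mul_const M) (fun k => ae_of_all _ fun ω => ?_) ?_
      · exact (((EuclideanSpace.proj i : EuclideanSpace ℝ (Fin d) →L[ℝ] ℝ).continuous.measurable.comp
          hX).smul (measurable_predictor.comp (hX.prodMk measurable_const))).aestronglyMeasurable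
      · rw [norm_smul, sq, mul_assoc]
        refine mul_le_mul (PiLp.norm_apply_le _ i) ?_ (norm_nonneg _) (norm_nonneg _)
        exact (norm_predictor_le _ _).trans (mul_le_mul_of_nonneg_left (hM _) (norm_nonneg _))
      · filter_upwards [hpred] with ω hω
        simpa using hω.const_smul (X ω i)
    simpa [integral_coord_smul_predictor hX2] using h1
  have hinv : ∀ (c : Slope H d) i, c i = ∑ l, S⁻¹ i l • ∑ j, S l j • c j := by
    intro c i
    simp only [Finset.smul_sum, smul_smul]
    rw [Finset.sum_comm]
    simp only [← Finset.sum_smul, ← Matrix.mul_apply, Matrix.nonsing_inv_mul _ hdet]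
    simp [Matrix.one_apply, ite_smul]
  have hcoord : ∀ i, Tendsto (fun k => b (φ k) i) atTop (𝓝 0) := by
    intro i
    have h1 : Tendsto (fun k => ∑ l, S⁻¹ i l • ∑ j, S l j • (b (φ k)) j) atTop
        (𝓝 (∑ l, S⁻¹ i l • (0 : H))) :=
      tendsto_finsetSum _ fun l _ => (hmoment l).const_smul _
    simp only [smul_zero, Finset.sum_const_zero] at h1
    exact h1.congr fun k => (hinv _ i).symm
  have h2 : Tendsto (fun k => WithLp.ofLp (b (φ k))) atTop (𝓝 0) := tendsto_pi_nhds.2 hcoord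
  exact ((PiLp.continuous_toLp 2 (fun _ : Fin d => H)).tendsto _).comp h2

end SlopeRisk

/-! ### Almost supermartingales -/

section Probability

variable {Ω : Type*} {m0 : MeasurableSpace Ω} {μ : Measure Ω} [IsProbabilityMeasure μ]

/-- If `A` is independent of `(B, C)` and `B` of `C`, then `(A, B)` is independent of `C`. -/
theorem indepFun_prodMk_of_indepFun {α β γ : Type*} [MeasurableSpace α] [MeasurableSpace β]
    [MeasurableSpace γ] {A : Ω → α} {B : Ω → β} {C : Ω → γ} (hA : Measurable A)
    (hB : Measurable B) (hC : Measurable C) (h1 : IndepFun A (fun ω => (B ω, C ω)) μ)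
    (h2 : IndepFun B C μ) : IndepFun (fun ω => (A ω, B ω)) C μ := by
  have hAB : IndepFun A B μ := h1.comp measurable_id measurable_fst
  have := Measure.isProbabilityMeasure_map (μ := μ) hA.aemeasurable
  have := Measure.isProbabilityMeasure_map (μ := μ) hB.aemeasurable
  have := Measure.isProbabilityMeasure_map (μ := μ) hC.aemeasurable
  rw [indepFun_iff_map_prod_eq_prod_map_map (hA.prodMk hB).aemeasurable hC.aemeasurable,
    (indepFun_iff_map_prod_eq_prod_map_map hA.aemeasurable hB.aemeasurable).1 hAB]
  have h3 := (indepFun_iff_map_prod_eq_prod_map_map hA.aemeasurable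
    (hB.prodMk hC).aemeasurable).1 h1
  rw [(indepFun_iff_map_prod_eq_prod_map_map hB.aemeasurable hC.aemeasurable).1 h2,
    ← Measure.prodAssoc_prod] at h3
  have h4 := congrArg (Measure.map MeasurableEquiv.prodAssoc.symm) h3
  rw [MeasurableEquiv.map_symm_map, Measure.map_map (MeasurableEquiv.measurable _)
    (hA.prodMk (hB.prodMk hC))] at h4
  exact h4

/-- **Robbins–Siegmund** almost-supermartingale theorem: if nonnegative adapted sequences satisfy
`E (V_{n+1} | ℱ_n) ≤ V_n - W_n + c_n`, with the `c_n` deterministic and summable, then `V`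
converges and `∑ W_n < ∞` almost surely. The conditional inequality is stated on the sets of
`ℱ_n`. -/
theorem ae_tendsto_and_summable_of_almost_supermartingale {ℱ : Filtration ℕ m0}
    {V W : ℕ → Ω → ℝ} {c : ℕ → ℝ} (hV : StronglyAdapted ℱ V) (hW : StronglyAdapted ℱ W)
    (hVi : ∀ n, Integrable (V n) μ) (hWi : ∀ n, Integrable (W n) μ) (hV0 : ∀ n ω, 0 ≤ V n ω)
    (hW0 : ∀ n ω, 0 ≤ W n ω) (hc0 : ∀ n, 0 ≤ c n) (hc : Summable c)
    (hstep : ∀ n s, MeasurableSet[ℱ n] s →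
      ∫ ω in s, V (n + 1) ω ∂μ ≤ ∫ ω in s, (V n ω - W n ω + c n) ∂μ) :
    ∀ᵐ ω ∂μ, (∃ L, Tendsto (fun n => V n ω) atTop (𝓝 L)) ∧ Summable (fun n => W n ω) := by
  -- `S` is the Doob correction of `V`; adding the tail `R` of `∑ c` keeps it nonnegative.
  set R : ℕ → ℝ := fun n => (∑' k, c k) - ∑ k ∈ Finset.range n, c k with hR
  have hR0 : ∀ n, 0 ≤ R n := fun n => sub_nonneg.2 (hc.sum_le_tsum _ fun k _ => hc0 k)
  have hRs : ∀ n, R n = c n + R (n + 1) := fun n => by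
    simp only [hR, Finset.sum_range_succ]; ring
  have hRlim : Tendsto R atTop (𝓝 0) := by
    simpa using hc.hasSum.tendsto_sum_nat.const_sub (∑' k, c k)
  set S : ℕ → Ω → ℝ := fun n ω => V n ω + ∑ k ∈ Finset.range n, W k ω + R n with hS
  have hS0 : ∀ n ω, 0 ≤ S n ω := fun n ω =>
    add_nonneg (add_nonneg (hV0 n ω) (Finset.sum_nonneg fun k _ => hW0 k ω)) (hR0 n)
  have hsumi : ∀ n, Integrable (fun ω => ∑ k ∈ Finset.range n, W k ω) μ := fun n =>
    integrable_finsetSum _ fun k _ => hWi k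
  have hSi : ∀ n, Integrable (S n) μ := fun n =>
    ((hVi n).add (hsumi n)).add (integrable_const _)
  have hSa : StronglyAdapted ℱ S := fun n =>
    ((hV n).add (Finset.stronglyMeasurable_fun_sum _ fun k hk =>
      (hW k).mono (ℱ.mono (Finset.mem_range.1 hk).le))).add stronglyMeasurable_const
  have hSstep : ∀ n s, MeasurableSet[ℱ n] s →
      ∫ ω in s, S (n + 1) ω ∂μ ≤ ∫ ω in s, S n ω ∂μ := by
    intro n s hs
    have hr1 : Integrable (fun ω => ∑ k ∈ Finset.range (n + 1), W k ω + R (n + 1))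
        (μ.restrict s) := ((hsumi (n + 1)).add (integrable_const _)).restrict
    have e1 : ∫ ω in s, S (n + 1) ω ∂μ = ∫ ω in s, V (n + 1) ω ∂μ
        + ∫ ω in s, (∑ k ∈ Finset.range (n + 1), W k ω + R (n + 1)) ∂μ := by
      rw [← integral_add (hVi _).restrict hr1]
      exact integral_congr_ae (ae_of_all _ fun ω => by simp only [hS]; ring)
    have e2 : ∫ ω in s, S n ω ∂μ = ∫ ω in s, (V n ω - W n ω + c n) ∂μ
        + ∫ ω in s, (∑ k ∈ Finset.range (n + 1), W k ω + R (n + 1)) ∂μ := by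
      have hr2 : Integrable (fun ω => V n ω - W n ω + c n) (μ.restrict s) :=
        (((hVi n).sub (hWi n)).add (integrable_const _)).restrict
      rw [← integral_add hr2 hr1]
      refine integral_congr_ae (ae_of_all _ fun ω => ?_)
      simp only [hS, hRs n, Finset.sum_range_succ]; ring
    rw [e1, e2]
    linarith [hstep n s hs]
  have hsuper : Supermartingale S ℱ μ := supermartingale_of_setIntegral_succ_le hSa hSi hSstep
  have hmean : ∀ n, ∫ ω, S n ω ∂μ ≤ ∫ ω, S 0 ω ∂μ := fun n => by
    simpa using hsuper.setIntegral_le (Nat.zero_le n) MeasurableSet.univ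
  have hbdd : ∀ n, eLpNorm ((-S) n) 1 μ ≤ ((∫ ω, S 0 ω ∂μ).toNNReal : ℝ≥0∞) := by
    intro n
    rw [Pi.neg_apply, eLpNorm_neg, eLpNorm_one_eq_lintegral_enorm]
    calc ∫⁻ ω, ‖S n ω‖ₑ ∂μ = ∫⁻ ω, ENNReal.ofReal (S n ω) ∂μ :=
          lintegral_congr fun ω => Real.enorm_of_nonneg (hS0 n ω)
      _ = ENNReal.ofReal (∫ ω, S n ω ∂μ) :=
          (ofReal_integral_eq_lintegral_ofReal (hSi n) (ae_of_all _ (hS0 n))).symm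
      _ ≤ _ := ENNReal.ofReal_le_ofReal (hmean n)
  filter_upwards [hsuper.neg.exists_ae_tendsto_of_bdd hbdd] with ω hω
  obtain ⟨l, hl⟩ := hω
  have hSl : Tendsto (fun n => S n ω) atTop (𝓝 (-l)) := by
    simpa using hl.neg
  obtain ⟨B, hB⟩ := hSl.bddAbove_range
  have hsum : Summable fun n => W n ω := by
    refine summable_of_sum_range_le (c := B) (fun n => hW0 n ω) fun n => ?_
    have h1 : S n ω ≤ B := hB ⟨n, rfl⟩
    have h2 := hV0 n ω
    have h3 := hR0 n
    simp only [hS] at h1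
    linarith
  refine ⟨⟨-l - ∑' k, W k ω - 0, ?_⟩, hsum⟩
  refine ((hSl.sub hsum.hasSum.tendsto_sum_nat).sub hRlim).congr fun n => ?_
  simp only [hS]; ring

/-- If `∑ g` diverges and `∑ g w` converges, with nonnegative terms, then `w` tends to zero along
a subsequence. -/
theorem exists_subseq_tendsto_zero_of_summable_mul {g w : ℕ → ℝ} (hg : ∀ n, 0 ≤ g n)
    (hw : ∀ n, 0 ≤ w n) (hdiv : ¬ Summable g) (hsum : Summable fun n => g n * w n) :
    ∃ φ : ℕ → ℕ, StrictMono φ ∧ Tendsto (fun k => w (φ k)) atTop (𝓝 0) := by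
  have hfreq : ∀ n : ℕ, ∃ᶠ k in atTop, w k < 1 / ((n : ℝ) + 1) := by
    intro n hn
    apply hdiv
    refine Summable.of_norm_bounded_eventually_nat (hsum.mul_left ((n : ℝ) + 1)) ?_
    filter_upwards [hn] with k hk
    have h1 : 1 ≤ ((n : ℝ) + 1) * w k := by
      rw [not_lt, div_le_iff₀ (by positivity)] at hk
      linarith
    rw [Real.norm_of_nonneg (hg k)]
    nlinarith [hg k, mul_le_mul_of_nonneg_left h1 (hg k)]
  obtain ⟨φ, hφ, hlt⟩ := extraction_forall_of_frequently hfreq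
  exact ⟨φ, hφ, squeeze_zero (fun k => hw _) (fun k => (hlt k).le)
    tendsto_one_div_add_atTop_nhds_zero_nat⟩

end Probability

/-! ### Conditioning on the past of the recursion -/

section Conditioning

variable {Ω : Type*} {m0 : MeasurableSpace Ω} {μ : Measure Ω} [IsProbabilityMeasure μ]

/-- Freezing lemma: if `D` is known to the σ-algebra `m` and `Z` is independent of `m`, then
the conditional expectation of `f (Z, D)` given `m` averages over `Z` with `D` held fixed. -/
theorem setIntegral_comp_eq_of_indep {Ω α β : Type*} {m m0 : MeasurableSpace Ω} {μ : Measure Ω}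
    [IsProbabilityMeasure μ] [MeasurableSpace α] [mβ : MeasurableSpace β] (hm : m ≤ m0) {D : Ω → α} {Z : Ω → β} (hD : Measurable[m] D)
    (hZ : Measurable Z) (hind : Indep m (mβ.comap Z) μ) {f : β × α → ℝ} (hf : Measurable f)
    (hfi : Integrable (fun ω => f (Z ω, D ω)) μ) {s : Set Ω} (hs : MeasurableSet[m] s) :
    ∫ ω in s, f (Z ω, D ω) ∂μ = ∫ ω in s, ∫ ω', f (Z ω', D ω) ∂μ ∂μ := by
  set W : Ω → α × ℝ := fun ω => (D ω, s.indicator (fun _ => (1 : ℝ)) ω) with hW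
  have hWm : Measurable[m] W := hD.prodMk (measurable_const.indicator hs)
  have hWm0 : Measurable W := hWm.mono hm le_rfl
  have hWZ : IndepFun W Z μ :=
    (IndepFun_iff_Indep _ _ _).2 (indep_of_indep_of_le_left hind hWm.comap_le)
  have hmap := (indepFun_iff_map_prod_eq_prod_map_map hWm0.aemeasurable hZ.aemeasurable).1 hWZ
  have := Measure.isProbabilityMeasure_map (μ := μ) hWm0.aemeasurable
  have := Measure.isProbabilityMeasure_map (μ := μ) hZ.aemeasurable
  set F : (α × ℝ) × β → ℝ := fun p => p.1.2 * f (p.2, p.1.1) with hF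
  have hFm : Measurable F := (measurable_snd.comp measurable_fst).mul
    (hf.comp (measurable_snd.prodMk (measurable_fst.comp measurable_fst)))
  have hFeq : (fun ω => F (W ω, Z ω)) = s.indicator fun ω => f (Z ω, D ω) := by
    ext ω
    by_cases h : ω ∈ s <;> simp [hF, hW, h]
  have hFi : Integrable F ((μ.map W).prod (μ.map Z)) := by
    rw [← hmap, integrable_map_measure hFm.aestronglyMeasurable (hWm0.prodMk hZ).aemeasurable]
    change Integrable (fun ω => F (W ω, Z ω)) μ
    rw [hFeq]
    exact hfi.indicator (hm s hs)
  have hinner : ∀ w, ∫ z, F (w, z) ∂(μ.map Z) = w.2 * ∫ ω', f (Z ω', w.1) ∂μ := by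
    intro w
    rw [← integral_const_mul, integral_map hZ.aemeasurable]
    exact (hFm.comp (measurable_const.prodMk measurable_id)).aestronglyMeasurable
  have hi := hFi.integral_prod_left
  rw [← integral_indicator (hm s hs), ← hFeq, ← integral_indicator (hm s hs)]
  have h1 : ∫ ω, F (W ω, Z ω) ∂μ = ∫ p, F p ∂((μ.map W).prod (μ.map Z)) := by
    rw [← hmap, integral_map (hWm0.prodMk hZ).aemeasurable hFm.aestronglyMeasurable]
  rw [h1, integral_prod _ hFi, integral_map hWm0.aemeasurable hi.aestronglyMeasurable]
  refine integral_congr_ae (ae_of_all _ fun ω => ?_)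
  simp only [hinner]
  by_cases h : ω ∈ s <;> simp [hW, h]

/-- The past of the recursion before step `n`: the starting point and the first `n` inputs. -/
def history {α β : Type*} (A : Ω → α) (Z : ℕ → Ω → β) (n : ℕ) (ω : Ω) :
    α × (Finset.range n → β) :=
  (A ω, fun i => Z i ω)

theorem measurable_history {α β : Type*} [MeasurableSpace α] [MeasurableSpace β] {A : Ω → α}
    {Z : ℕ → Ω → β} (hA : Measurable A) (hZ : ∀ n, Measurable (Z n)) (n : ℕ) :
    Measurable (history A Z n) :=
  hA.prodMk (measurable_pi_lambda _ fun i => hZ i)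

/-- The filtration generated by the starting point and the successive inputs. -/
def historyFiltration {α β : Type*} [MeasurableSpace α] [MeasurableSpace β] {A : Ω → α}
    {Z : ℕ → Ω → β} (hA : Measurable A) (hZ : ∀ n, Measurable (Z n)) : Filtration ℕ m0 where
  seq n := MeasurableSpace.comap (history A Z n) inferInstance
  mono' i j hij := by
    have h : history A Z i = (fun p : α × (Finset.range j → β) =>
        (p.1, fun k : Finset.range i => p.2 ⟨k, Finset.range_mono hij k.2⟩)) ∘ history A Z j := rfl
    have hp : Measurable (fun p : α × (Finset.range j → β) =>
        (p.1, fun k : Finset.range i => p.2 ⟨k, Finset.range_mono hij k.2⟩)) :=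
      measurable_fst.prodMk (measurable_pi_lambda _ fun k =>
        (measurable_pi_apply _).comp measurable_snd)
    change MeasurableSpace.comap (history A Z i) _ ≤ MeasurableSpace.comap (history A Z j) _
    rw [h, ← MeasurableSpace.comap_comp]
    exact MeasurableSpace.comap_mono hp.comap_le
  le' n := (measurable_history hA hZ n).comap_le

theorem indep_historyFiltration {α β : Type*} [MeasurableSpace α] [mβ : MeasurableSpace β]
    {A : Ω → α} {Z : ℕ → Ω → β} (hA : Measurable A) (hZ : ∀ n, Measurable (Z n))
    (hind : iIndepFun Z μ) (hAZ : IndepFun A (fun ω n => Z n ω) μ) (n : ℕ) :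
    Indep (historyFiltration hA hZ n) (mβ.comap (Z n)) μ := by
  rw [historyFiltration]
  refine (IndepFun_iff_Indep _ _ _).1 (indepFun_prodMk_of_indepFun hA
    (measurable_pi_lambda _ fun i => hZ i) (hZ n) ?_ ?_)
  · exact hAZ.comp measurable_id (ψ := fun z : ℕ → β => (fun i : Finset.range n => z i, z n))
      ((measurable_pi_lambda _ fun i => measurable_pi_apply _).prodMk (measurable_pi_apply _))
  · exact (hind.indepFun_finset (Finset.range n) {n} (by simp) hZ).comp measurable_id
      (measurable_pi_apply (⟨n, Finset.mem_singleton_self n⟩ : ({n} : Finset ℕ)))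

end Conditioning

/-! ### Convergence of the error -/

section Recursion

variable {H : Type*} [NormedAddCommGroup H] [InnerProductSpace ℝ H] {d : ℕ}

/-- The error of stochastic gradient descent, that is its iterates when the true slope is `0` and
the responses are the noise variables `u`; indices start at `0`. -/
noncomputable def sgdError (g : ℕ → ℝ) (x : ℕ → EuclideanSpace ℝ (Fin d)) (u : ℕ → H)
    (b : Slope H d) : ℕ → Slope H d
  | 0 => b
  | n + 1 => sgdStep (g n) (x n) (u n) (sgdError g x u b n)

theorem sgd_sub_eq_sgdError (g : ℕ → ℝ) (x : ℕ → EuclideanSpace ℝ (Fin d)) (u y : ℕ → H)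
    (β b : Slope H d) (hy : ∀ i, 1 ≤ i → y i = predictor (x i) β + u i) (n : ℕ) :
    sgd g x y b (n + 1) - β =
      sgdError (fun k => g (k + 1)) (fun k => x (k + 2)) (fun k => u (k + 2)) (b - β) n := by
  induction n with
  | zero => rfl
  | succ n ih =>
    rw [sgd, hy (n + 2) (by omega), sgdStep_sub, ih, sgdError]

variable {Ω : Type*} {m0 : MeasurableSpace Ω} {μ : Measure Ω} [IsProbabilityMeasure μ]
variable [SecondCountableTopology H] [MeasurableSpace H] [BorelSpace H]
  {g : ℕ → ℝ} {X : ℕ → Ω → EuclideanSpace ℝ (Fin d)} {U : ℕ → Ω → H} {D : Ω → Slope H d}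
  {X₀ : Ω → EuclideanSpace ℝ (Fin d)} {U₀ : Ω → H}

omit [IsProbabilityMeasure μ] in
theorem slopeRisk_eq_of_identDistrib {X' : Ω → EuclideanSpace ℝ (Fin d)} {U' : Ω → H}
    {X'' : Ω → EuclideanSpace ℝ (Fin d)} {U'' : Ω → H}
    (h : IdentDistrib (fun ω => (X' ω, U' ω)) (fun ω => (X'' ω, U'' ω)) μ μ) (b : Slope H d) :
    slopeRisk μ X' U' b = slopeRisk μ X'' U'' b :=
  (h.comp (measurable_excess.comp (measurable_id.prodMk
    (measurable_const : Measurable fun _ : EuclideanSpace ℝ (Fin d) × H => b)))).integral_eq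

/-- Almost sure convergence of the error from a square integrable start: the squared error is an
almost supermartingale, so it converges and `∑ g_n slopeRisk (error_n) < ∞`. As `∑ g_n = ∞`,
the risk tends to zero along a subsequence, and a further subsequence of the error does. -/
theorem ae_tendsto_sgdError_of_memLp [CompleteSpace H] (hg : ∀ n, 0 ≤ g n)
    (hdiv : ¬ Summable g) (hsq : Summable fun n => g n ^ 2)
    (hX : ∀ n, Measurable (X n)) (hU : ∀ n, Measurable (U n)) (hD : Measurable D)
    (hX₀ : Measurable X₀) (hU₀ : Measurable U₀)
    (hid : ∀ n, IdentDistrib (fun ω => (X n ω, U n ω)) (fun ω => (X₀ ω, U₀ ω)) μ μ)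
    (hXU : IndepFun X₀ U₀ μ) (hind : iIndepFun (fun n ω => (X n ω, U n ω)) μ)
    (hDind : IndepFun D (fun ω n => (X n ω, U n ω)) μ)
    (hcov : CovariateCondition μ X₀) (hmed : UniqueMedianZero μ U₀) (hD2 : MemLp D 2 μ) :
    ∀ᵐ ω ∂μ, Tendsto (sgdError g (fun n => X n ω) (fun n => U n ω) (D ω)) atTop (𝓝 0) := by
  set Z : ℕ → Ω → EuclideanSpace ℝ (Fin d) × H := fun n ω => (X n ω, U n ω) with hZdef
  have hZ : ∀ n, Measurable (Z n) := fun n => (hX n).prodMk (hU n)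
  set ℱ := historyFiltration hD hZ with hℱ
  set E : ℕ → Ω → Slope H d := fun n ω => sgdError g (fun n => X n ω) (fun n => U n ω) (D ω) n
    with hE
  have hX2 : ∀ n, MemLp (X n) 2 μ := fun n =>
    ((hid n).comp measurable_fst).symm.memLp_snd hcov.1
  have hEm : ∀ n, Measurable[ℱ n] (E n) := by
    intro n
    induction n with
    | zero =>
      exact measurable_fst.comp (comap_measurable (history D Z 0))
    | succ n ih =>
      have h1 : Measurable[ℱ (n + 1)] (Z n) :=
        ((measurable_pi_apply (⟨n, Finset.self_mem_range_succ n⟩ : Finset.range (n + 1))).comp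
          measurable_snd).comp (comap_measurable (history D Z (n + 1)))
      exact (measurable_sgdStep (g n)).comp (h1.prodMk (ih.mono (ℱ.mono n.le_succ) le_rfl))
  have hEm0 : ∀ n, Measurable (E n) := fun n => (hEm n).mono (ℱ.le n) le_rfl
  have hE2 : ∀ n, MemLp (E n) 2 μ := by
    intro n
    induction n with
    | zero => exact hD2
    | succ n ih =>
      refine (ih.norm.add ((hX2 n).norm.const_mul (g n))).mono'
        (hEm0 (n + 1)).aestronglyMeasurable (ae_of_all _ fun ω => ?_)
      exact norm_sgdStep_le (hg n) _ _ _
  set Φ : Slope H d → ℝ := slopeRisk μ X₀ U₀ with hΦ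
  have hΦ0 : ∀ b, 0 ≤ Φ b := slopeRisk_nonneg hX₀ hcov.1 hU₀ hXU hmed
  have hΦm : Measurable Φ := measurable_slopeRisk hX₀ hU₀
  set σ2 : ℝ := ∫ ω, ‖X₀ ω‖ ^ 2 ∂μ with hσ2
  have hσ20 : 0 ≤ σ2 := integral_nonneg fun ω => sq_nonneg _
  have hσ2n : ∀ n, ∫ ω, ‖X n ω‖ ^ 2 ∂μ = σ2 := fun n =>
    (((hid n).comp measurable_fst).comp
      (u := fun x : EuclideanSpace ℝ (Fin d) => ‖x‖ ^ 2) (by fun_prop)).integral_eq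
  have hWi : ∀ n, Integrable (fun ω => 2 * g n * Φ (E n ω)) μ := fun n => by
    refine Integrable.const_mul ?_ _
    refine (((hE2 n).integrable (by norm_num)).norm.const_mul (∫ ω, ‖X₀ ω‖ ∂μ)).mono'
      (hΦm.comp (hEm0 n)).aestronglyMeasurable (ae_of_all _ fun ω => ?_)
    exact abs_slopeRisk_le hcov.1 _
  have hVi : ∀ n, Integrable (fun ω => ‖E n ω‖ ^ 2) μ := fun n =>
    (hE2 n).integrable_norm_pow two_ne_zero
  have hnsq : Measurable fun b : Slope H d => ‖b‖ ^ 2 := by fun_prop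
  have hRS := ae_tendsto_and_summable_of_almost_supermartingale (μ := μ) (ℱ := ℱ)
    (V := fun n ω => ‖E n ω‖ ^ 2) (W := fun n ω => 2 * g n * Φ (E n ω))
    (c := fun n => g n ^ 2 * σ2)
    (fun n => (hnsq.comp (hEm n)).stronglyMeasurable)
    (fun n => ((hΦm.const_mul (2 * g n)).comp (hEm n)).stronglyMeasurable)
    hVi hWi (fun n ω => sq_nonneg _)
    (fun n ω => mul_nonneg (mul_nonneg zero_le_two (hg n)) (hΦ0 _))
    (fun n => mul_nonneg (sq_nonneg _) hσ20) (hsq.mul_right σ2) ?_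
  · filter_upwards [hRS] with ω hω
    obtain ⟨⟨L, hL⟩, hsum⟩ := hω
    have hsum' : Summable fun n => g n * Φ (E n ω) := by
      refine (hsum.mul_left (1 / 2)).congr fun n => by ring
    obtain ⟨φ, hφ, hφlim⟩ :=
      exists_subseq_tendsto_zero_of_summable_mul hg (fun n => hΦ0 (E n ω)) hdiv hsum'
    obtain ⟨B, hB⟩ := hL.bddAbove_range
    have hbound : ∀ k, ‖E (φ k) ω‖ ≤ √B := fun k =>
      Real.le_sqrt_of_sq_le (hB ⟨φ k, rfl⟩)
    obtain ⟨ψ, hψ, hψlim⟩ := exists_subseq_tendsto_zero_of_slopeRisk hX₀ hcov hU₀ hXU hmed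
      hbound hφlim
    have h1 : Tendsto (fun k => ‖E (φ (ψ k)) ω‖ ^ 2) atTop (𝓝 0) := by
      simpa using hψlim.norm.pow 2
    have hL0 : L = 0 := tendsto_nhds_unique
      (hL.comp (hφ.tendsto_atTop.comp hψ.tendsto_atTop)) h1
    rw [hL0] at hL
    refine tendsto_zero_iff_norm_tendsto_zero.2 ?_
    have h2 := (Real.continuous_sqrt.tendsto _).comp hL
    rw [Real.sqrt_zero] at h2
    exact h2.congr fun n => Real.sqrt_sq (norm_nonneg _)
  · intro n s hs
    set f : (EuclideanSpace ℝ (Fin d) × H) × Slope H d → ℝ := fun p =>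
      ‖p.2‖ ^ 2 - 2 * g n * (‖p.1.2 - predictor p.1.1 p.2‖ - ‖p.1.2‖) + g n ^ 2 * ‖p.1.1‖ ^ 2
      with hf
    have hfm : Measurable f :=
      ((measurable_snd.norm.pow_const 2).sub (measurable_excess.const_mul _)).add
        (((measurable_fst.comp measurable_fst).norm.pow_const 2).const_mul _)
    have hXi : ∀ n, Integrable (fun ω => ‖X n ω‖ ^ 2) μ := fun n =>
      (hX2 n).integrable_norm_pow two_ne_zero
    have hexc : Integrable (fun ω => ‖U n ω - predictor (X n ω) (E n ω)‖ - ‖U n ω‖) μ := by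
      refine ((hX2 n).norm.integrable_mul (hE2 n).norm).mono'
        (measurable_excess.comp ((hZ n).prodMk (hEm0 n))).aestronglyMeasurable
        (ae_of_all _ fun ω => ?_)
      exact abs_norm_sub_predictor_sub_le (X n ω) (U n ω) (E n ω)
    have hfi : Integrable (fun ω => f (Z n ω, E n ω)) μ :=
      ((hVi n).sub (hexc.const_mul _)).add ((hXi n).const_mul _)
    calc ∫ ω in s, ‖E (n + 1) ω‖ ^ 2 ∂μ ≤ ∫ ω in s, f (Z n ω, E n ω) ∂μ :=
          integral_mono (hVi _).restrict hfi.restrict fun ω => norm_sgdStep_sq_le (hg n) _ _ _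
      _ = ∫ ω in s, ∫ ω', f (Z n ω', E n ω) ∂μ ∂μ :=
          setIntegral_comp_eq_of_indep (ℱ.le n) (hEm n) (hZ n)
            (indep_historyFiltration hD hZ hind hDind n) hfm hfi hs
      _ = ∫ ω in s, (‖E n ω‖ ^ 2 - 2 * g n * Φ (E n ω) + g n ^ 2 * σ2) ∂μ := by
          refine integral_congr_ae (ae_of_all _ fun ω => ?_)
          have he := integrable_excess (hX n) (hX2 n) (hU n) (E n ω)
          have h1 : slopeRisk μ (X n) (U n) (E n ω) = Φ (E n ω) :=
            slopeRisk_eq_of_identDistrib (hid n) _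
          change ∫ ω', (‖E n ω‖ ^ 2 - 2 * g n * (‖U n ω' - predictor (X n ω') (E n ω)‖ - ‖U n ω'‖)
            + g n ^ 2 * ‖X n ω'‖ ^ 2) ∂μ = _
          have hi1 : Integrable (fun ω' => 2 * g n *
              (‖U n ω' - predictor (X n ω') (E n ω)‖ - ‖U n ω'‖)) μ := he.const_mul _
          have hi2 : Integrable (fun ω' => ‖E n ω‖ ^ 2 - 2 * g n *
              (‖U n ω' - predictor (X n ω') (E n ω)‖ - ‖U n ω'‖)) μ := (integrable_const _).sub hi1
          rw [integral_add hi2 ((hXi n).const_mul _), integral_sub (integrable_const _) hi1,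
            integral_const_mul, integral_const_mul, hσ2n]
          simp [← h1, slopeRisk]

/-- Almost sure convergence of the error from an arbitrary start. On the event that the start has
norm at most `K` the path is that of the truncated, hence square integrable, start. -/
theorem ae_tendsto_sgdError [CompleteSpace H] (hg : ∀ n, 0 ≤ g n)
    (hdiv : ¬ Summable g) (hsq : Summable fun n => g n ^ 2)
    (hX : ∀ n, Measurable (X n)) (hU : ∀ n, Measurable (U n)) (hD : Measurable D)
    (hX₀ : Measurable X₀) (hU₀ : Measurable U₀)
    (hid : ∀ n, IdentDistrib (fun ω => (X n ω, U n ω)) (fun ω => (X₀ ω, U₀ ω)) μ μ)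
    (hXU : IndepFun X₀ U₀ μ) (hind : iIndepFun (fun n ω => (X n ω, U n ω)) μ)
    (hDind : IndepFun D (fun ω n => (X n ω, U n ω)) μ)
    (hcov : CovariateCondition μ X₀) (hmed : UniqueMedianZero μ U₀) :
    ∀ᵐ ω ∂μ, Tendsto (sgdError g (fun n => X n ω) (fun n => U n ω) (D ω)) atTop (𝓝 0) := by
  set T : ℕ → Slope H d → Slope H d := fun K => (Metric.closedBall 0 (K : ℝ)).indicator id with hT
  have hTm : ∀ K, Measurable (T K) := fun K =>
    measurable_id.indicator Metric.isClosed_closedBall.measurableSet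
  have hTb : ∀ K b, ‖T K b‖ ≤ K := by
    intro K b
    by_cases h : b ∈ Metric.closedBall (0 : Slope H d) (K : ℝ)
    · simp only [hT]
      rw [Set.indicator_of_mem h]
      simpa using h
    · simp only [hT]
      rw [Set.indicator_of_notMem h]
      simp
  have hall : ∀ᵐ ω ∂μ, ∀ K : ℕ,
      Tendsto (sgdError g (fun n => X n ω) (fun n => U n ω) (T K (D ω))) atTop (𝓝 0) :=
    ae_all_iff.2 fun K => ae_tendsto_sgdError_of_memLp hg hdiv hsq hX hU ((hTm K).comp hD) hX₀ hU₀
      hid hXU hind (hDind.comp (hTm K) measurable_id) hcov hmed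
      (MemLp.of_bound ((hTm K).comp hD).aestronglyMeasurable K (ae_of_all _ fun ω => hTb K (D ω)))
  filter_upwards [hall] with ω hω
  obtain ⟨K, hK⟩ := exists_nat_ge ‖D ω‖
  have h1 : T K (D ω) = D ω := Set.indicator_of_mem (by simpa using hK) _
  simpa only [h1] using hω K

end Recursion

/-! ### Step sizes -/

section StepSize

theorem sum_Icc_one_eq_sum_range {E : Type*} [AddCommMonoid E] (f : ℕ → E) (n : ℕ) :
    ∑ i ∈ Finset.Icc 1 n, f i = ∑ i ∈ Finset.range n, f (i + 1) := by
  rw [Finset.range_eq_Ico, Finset.sum_Ico_add']; rfl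

theorem RobbinsMonro.not_summable {g : ℕ → ℝ} (h : RobbinsMonro g) (hg : ∀ n, 0 ≤ g n) :
    ¬ Summable fun n => g (n + 1) := by
  rw [not_summable_iff_tendsto_nat_atTop_of_nonneg fun n => hg _]
  simpa only [sum_Icc_one_eq_sum_range] using h.1

theorem stepSize_nonneg {γ : ℝ} (hγ : 0 < γ) (α : ℝ) (n : ℕ) : 0 ≤ stepSize γ α n :=
  mul_nonneg hγ.le (Real.rpow_nonneg n.cast_nonneg _)

end StepSize

end OnlineFSRM

theorem proposition1
    {H : Type*} [NormedAddCommGroup H] [InnerProductSpace ℝ H] [CompleteSpace H]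
    [TopologicalSpace.SeparableSpace H] [MeasurableSpace H] [BorelSpace H]
    {d : ℕ} {Ω : Type*} [MeasurableSpace Ω] (μ : Measure Ω) [IsProbabilityMeasure μ]
    (β : OnlineFSRM.Slope H d) (X : ℕ → Ω → EuclideanSpace ℝ (Fin d)) (U Y : ℕ → Ω → H)
    (init : Ω → OnlineFSRM.Slope H d)
    (hsample : OnlineFSRM.IsSample μ β X U Y init)
    (hX : OnlineFSRM.CovariateCondition μ (X 1))
    (hU : OnlineFSRM.UniqueMedianZero μ (U 1))
    (hU' : OnlineFSRM.NotConcentrated μ (U 1))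
    (γ α : ℝ) (hγ : 0 < γ)
    (hstep : OnlineFSRM.RobbinsMonro (OnlineFSRM.stepSize γ α)) :
    (∀ᵐ ω ∂μ, Tendsto (fun n : ℕ => ‖OnlineFSRM.sgd (OnlineFSRM.stepSize γ α)
        (fun i => X i ω) (fun i => Y i ω) (init ω) n - β‖) atTop (𝓝 0)) ∧
    (∀ᵐ ω ∂μ, Tendsto (fun n : ℕ => ‖OnlineFSRM.asgd (OnlineFSRM.stepSize γ α)
        (fun i => X i ω) (fun i => Y i ω) (init ω) n - β‖) atTop (𝓝 0)) := by
  have : SecondCountableTopology H := UniformSpace.secondCountable_of_separable H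
  have hg := OnlineFSRM.stepSize_nonneg hγ α
  have hmain : ∀ᵐ ω ∂μ, Tendsto (OnlineFSRM.sgdError
      (fun k => OnlineFSRM.stepSize γ α (k + 1)) (fun k => X (k + 2) ω) (fun k => U (k + 2) ω)
      (init ω - β)) atTop (𝓝 0) := by
    refine OnlineFSRM.ae_tendsto_sgdError (X := fun n => X (n + 2)) (U := fun n => U (n + 2))
      (D := fun ω => init ω - β) (fun n => hg _) (hstep.not_summable hg) hstep.2
      (fun n => hsample.measurable_X _ (by omega)) (fun n => hsample.measurable_U _ (by omega))
      (hsample.measurable_init.sub_const β) (hsample.measurable_X 1 le_rfl)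
      (hsample.measurable_U 1 le_rfl) (fun n => hsample.identDistrib _ (by omega))
      (hsample.indep_X_U 1 le_rfl) (hsample.indep.precomp (add_left_injective 1))
      (hsample.indep_init.comp (measurable_id.sub_const β) measurable_id) hX hU
  have hsgd : ∀ᵐ ω ∂μ, Tendsto (OnlineFSRM.sgd (OnlineFSRM.stepSize γ α)
      (fun i => X i ω) (fun i => Y i ω) (init ω)) atTop (𝓝 β) := by
    filter_upwards [hmain] with ω hω
    rw [← tendsto_add_atTop_iff_nat 1, ← tendsto_sub_nhds_zero_iff]
    refine hω.congr fun n => ?_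
    exact (OnlineFSRM.sgd_sub_eq_sgdError _ _ (fun i => U i ω) _ _ _
      (fun i hi => hsample.model i hi ω) n).symm
  constructor
  · filter_upwards [hsgd] with ω hω
    exact tendsto_iff_norm_sub_tendsto_zero.1 hω
  · filter_upwards [hsgd] with ω hω
    refine tendsto_iff_norm_sub_tendsto_zero.1 ?_
    unfold OnlineFSRM.asgd
    simp only [OnlineFSRM.sum_Icc_one_eq_sum_range]
    exact ((tendsto_add_atTop_iff_nat 1).2 hω).cesaro_smul
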